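/- Let $S$ be a finite set of distinct positive integers which is GCD closed, that is, $\gcd(a,b)\in S$ for all $a,b\in S$, and let $[S]$ be its LCM matrix, the $|S|\times|S|$ matrix whose rows and columns are indexed by the elements of $S$ and whose entry at $(a,b)$ is $\operatorname{lcm}(a,b)$. 1. If $|S|\le 7$, then $[S]$ is invertible. 2. If $|S|=8$ and $[S]$ is not invertible, then the partially ordered set $(S,\mid)$ (ordered by divisibility) is isomorphic to the cube semilattice, that is, to the set of all subsets of a three-element set ordered by inclusion. Here invertible means invertible as a real matrix. -/

import Mathlib

/-- A finite set of natural numbers is GCD closed if it contains the greatest common divisor of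
any two of its elements. -/
def GCDClosed (S : Finset ℕ) : Prop :=
  ∀ a ∈ S, ∀ b ∈ S, Nat.gcd a b ∈ S

/-- The LCM matrix `[S]`, as a real matrix with rows and columns indexed by the elements of `S`:
the entry at `(a, b)` is `lcm(a, b)`. -/
def lcmMatrix (S : Finset ℕ) : Matrix S S ℝ :=
  Matrix.of fun a b => (Nat.lcm (a : ℕ) (b : ℕ) : ℝ)

/-- The divisibility relation on the elements of `S`, that is, the order of `(S, |)`. -/
def dvdRel (S : Finset ℕ) : S → S → Prop :=
  fun a b => (a : ℕ) ∣ (b : ℕ)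

/-- The order of the cube semilattice: the eight subsets of a three-element set (the vertices
of a cube), ordered by inclusion. -/
def cubeRel : Finset (Fin 3) → Finset (Fin 3) → Prop :=
  fun A B => A ⊆ B

/-! Since lcm(a, b) = ab / gcd(a, b) and S is GCD closed, [S] = B D Bᵀ with B invertible and
triangular and D diagonal, its entries g(x) (`recipTransform`) being the Möbius transform of 1/x on
(S, ∣). If [S] is singular, some g(x) = 0.

Replacing each divisor d ∈ S of x by x / d gives an lcm-closed set T containing 1, and x g(x) is the
alternating sum `altLcm T` over sets of atoms (`altLcm_codivisors`). For |T| ≤ 8, four or more atoms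
leave at most three nonatoms, whose weights outbalance the atoms, so the sum is positive
(`altLcm_pos_of_four_le`). Fewer than three atoms, or three dependent ones, also give a nonzero sum,
by a + b < lcm(a, b). So three independent atoms exist; their lcms form a cube, which embeds in S
upside down. Hence |S| ≥ 8, and equality makes the embedding an isomorphism. -/

/-! ### Lcm-closed sets and the cross-cut Möbius function. -/

/-- A finite set of positive integers that contains `1` and is closed under `lcm`. -/
structure IsLcmClosed (T : Finset ℕ) : Prop where
  pos : ∀ t ∈ T, 0 < t
  one_mem : 1 ∈ T
  lcm_mem : ∀ a ∈ T, ∀ b ∈ T, Nat.lcm a b ∈ T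

/-- The elements of `T` that cover `1` in the divisibility order. -/
def dvdAtoms (T : Finset ℕ) : Finset ℕ :=
  {t ∈ T | t ≠ 1 ∧ ∀ s ∈ T, s ∣ t → s = 1 ∨ s = t}

/-- The alternating sum of the least common multiples of the sets of atoms of `T`. -/
def altLcm (T : Finset ℕ) : ℤ :=
  ∑ I ∈ (dvdAtoms T).powerset, (-1) ^ I.card * (I.lcm id : ℕ)

/-- The Möbius function `μ(1, t)` of `(T, ∣)`, by the cross-cut formula. -/
def crosscut (T : Finset ℕ) (t : ℕ) : ℤ :=
  ∑ I ∈ (dvdAtoms T).powerset with I.lcm id = t, (-1) ^ I.card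

/-- The lcm is a proper multiple of both, so at least 2a and 2b, hence at least their average;
equality would force a = b. -/
theorem add_lt_lcm {a b : ℕ} (ha : 0 < a) (hb : 0 < b) (hab : ¬ a ∣ b) (hba : ¬ b ∣ a) :
    a + b < Nat.lcm a b := by
  have hl : 0 < Nat.lcm a b := Nat.lcm_pos ha hb
  have hne : a ≠ b := fun h => hab (h ▸ dvd_rfl)
  obtain ⟨u, hu⟩ := Nat.dvd_lcm_left a b
  obtain ⟨v, hv⟩ := Nat.dvd_lcm_right a b
  have hu2 : 2 ≤ u := by
    by_contra h
    interval_cases u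
    · omega
    · exact hba ((Nat.dvd_lcm_right a b).trans (by rw [hu, mul_one]))
  have hv2 : 2 ≤ v := by
    by_contra h
    interval_cases v
    · omega
    · exact hab ((Nat.dvd_lcm_left a b).trans (by rw [hv, mul_one]))
  have h1 := Nat.mul_le_mul_left a hu2
  have h2 := Nat.mul_le_mul_left b hv2
  omega

theorem two_mul_le_of_dvd {a b : ℕ} (hb : 0 < b) (h : a ∣ b) (hne : a ≠ b) : 2 * a ≤ b := by
  obtain ⟨c, rfl⟩ := h
  have hc : 2 ≤ c := by
    by_contra h
    interval_cases c <;> simp_all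
  nlinarith

theorem mem_dvdAtoms {T : Finset ℕ} {t : ℕ} :
    t ∈ dvdAtoms T ↔ t ∈ T ∧ t ≠ 1 ∧ ∀ s ∈ T, s ∣ t → s = 1 ∨ s = t := by
  simp [dvdAtoms]

theorem dvdAtoms_subset (T : Finset ℕ) : dvdAtoms T ⊆ T := Finset.filter_subset _ _

theorem eq_of_dvd_of_mem_dvdAtoms {T : Finset ℕ} {a b : ℕ} (ha : a ∈ dvdAtoms T)
    (hb : b ∈ dvdAtoms T) (h : a ∣ b) : a = b :=
  ((mem_dvdAtoms.1 hb).2.2 a (dvdAtoms_subset T ha) h).resolve_left (mem_dvdAtoms.1 ha).2.1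

theorem exists_dvdAtom_dvd {T : Finset ℕ} (hT : IsLcmClosed T) {t : ℕ} (ht : t ∈ T) (h1 : t ≠ 1) :
    ∃ a ∈ dvdAtoms T, a ∣ t := by
  induction t using Nat.strong_induction_on with
  | _ t ih =>
    by_cases h : t ∈ dvdAtoms T
    · exact ⟨t, h, dvd_rfl⟩
    · rw [mem_dvdAtoms] at h
      push Not at h
      obtain ⟨s, hs, hst, hs1, hne⟩ := h ht h1
      obtain ⟨a, ha, has⟩ := ih s (lt_of_le_of_ne (Nat.le_of_dvd (hT.pos t ht) hst) hne) hs hs1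
      exact ⟨a, ha, has.trans hst⟩

theorem IsLcmClosed.finset_lcm_mem {T : Finset ℕ} (hT : IsLcmClosed T) {I : Finset ℕ}
    (hI : I ⊆ T) : I.lcm id ∈ T := by
  induction I using Finset.induction_on with
  | empty => simpa using hT.one_mem
  | insert a I _ ih =>
    rw [Finset.lcm_insert]
    exact hT.lcm_mem _ (hI (Finset.mem_insert_self a I)) _
      (ih ((Finset.subset_insert a I).trans hI))

theorem IsLcmClosed.powerset_lcm_mem {T : Finset ℕ} (hT : IsLcmClosed T) {I : Finset ℕ}
    (hI : I ∈ (dvdAtoms T).powerset) : I.lcm id ∈ T :=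
  hT.finset_lcm_mem ((Finset.mem_powerset.1 hI).trans (dvdAtoms_subset T))

theorem altLcm_eq_sum_crosscut {T : Finset ℕ} (hT : IsLcmClosed T) :
    altLcm T = ∑ t ∈ T, crosscut T t * t := by
  unfold altLcm crosscut
  rw [← Finset.sum_fiberwise_of_maps_to (g := fun I : Finset ℕ => I.lcm id)
    (fun I hI => hT.powerset_lcm_mem hI)]
  refine Finset.sum_congr rfl fun t _ => ?_
  rw [Finset.sum_mul]
  refine Finset.sum_congr rfl fun I hI => ?_
  rw [(Finset.mem_filter.1 hI).2]

/-- The sets of atoms whose lcm divides t are the subsets of the atoms dividing t; their signs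
cancel unless there is no such atom, that is, t = 1. -/
theorem sum_crosscut_dvd {T : Finset ℕ} (hT : IsLcmClosed T) {t : ℕ} (ht : t ∈ T) :
    ∑ s ∈ T with s ∣ t, crosscut T s = if t = 1 then 1 else 0 := by
  have h1 : ∑ s ∈ T with s ∣ t, crosscut T s =
      ∑ I ∈ {a ∈ dvdAtoms T | a ∣ t}.powerset, (-1 : ℤ) ^ I.card := by
    have hset : {a ∈ dvdAtoms T | a ∣ t}.powerset =
        {I ∈ (dvdAtoms T).powerset | I.lcm id ∣ t} := by
      ext I
      simp only [Finset.mem_powerset, Finset.mem_filter, Finset.lcm_dvd_iff, id,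
        Finset.subset_iff]
      exact forall₂_and
    rw [hset, ← Finset.sum_fiberwise_of_maps_to (g := fun I : Finset ℕ => I.lcm id)
      (t := {s ∈ T | s ∣ t})]
    · refine Finset.sum_congr rfl fun s hs => ?_
      rw [crosscut, Finset.filter_filter]
      refine Finset.sum_congr (Finset.filter_congr fun I _ => ?_) fun _ _ => rfl
      constructor
      · rintro rfl
        exact ⟨(Finset.mem_filter.1 hs).2, rfl⟩
      · exact fun h => h.2
    · intro I hI
      rw [Finset.mem_filter] at hI ⊢
      exact ⟨hT.powerset_lcm_mem hI.1, hI.2⟩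
  rw [h1, Finset.sum_powerset_neg_one_pow_card]
  refine if_congr ?_ rfl rfl
  rw [Finset.filter_eq_empty_iff]
  constructor
  · intro h
    by_contra hne
    obtain ⟨a, ha, hat⟩ := exists_dvdAtom_dvd hT ht hne
    exact h ha hat
  · rintro rfl a ha h
    exact (mem_dvdAtoms.1 ha).2.1 (Nat.dvd_one.1 h)

theorem crosscut_one {T : Finset ℕ} (hT : IsLcmClosed T) : crosscut T 1 = 1 := by
  have h := sum_crosscut_dvd hT hT.one_mem
  have hset : {s ∈ T | s ∣ 1} = {1} := by
    ext s
    simp only [Finset.mem_filter, Nat.dvd_one, Finset.mem_singleton]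
    exact ⟨fun h => h.2, fun h => ⟨h ▸ hT.one_mem, h⟩⟩
  rwa [hset, Finset.sum_singleton, if_pos rfl] at h

theorem crosscut_of_mem_dvdAtoms {T : Finset ℕ} (hT : IsLcmClosed T) {a : ℕ}
    (ha : a ∈ dvdAtoms T) : crosscut T a = -1 := by
  obtain ⟨haT, ha1, hmin⟩ := mem_dvdAtoms.1 ha
  have h := sum_crosscut_dvd hT haT
  have hset : {s ∈ T | s ∣ a} = {1, a} := by
    ext s
    simp only [Finset.mem_filter, Finset.mem_insert, Finset.mem_singleton]
    constructor
    · exact fun h => hmin s h.1 h.2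
    · rintro (rfl | rfl)
      · exact ⟨hT.one_mem, one_dvd _⟩
      · exact ⟨haT, dvd_rfl⟩
  rw [hset, Finset.sum_pair (Ne.symm ha1), crosscut_one hT, if_neg ha1] at h
  linarith

/-! ### Weights of the nonatoms. -/

/-- The elements of `T` that are neither `1` nor atoms. -/
def dvdNonatoms (T : Finset ℕ) : Finset ℕ := T \ insert 1 (dvdAtoms T)

theorem mem_dvdNonatoms {T : Finset ℕ} {t : ℕ} :
    t ∈ dvdNonatoms T ↔ t ∈ T ∧ t ≠ 1 ∧ t ∉ dvdAtoms T := by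
  simp [dvdNonatoms]

theorem sum_eq_one_add_atoms_add_nonatoms {T : Finset ℕ} (hT : IsLcmClosed T) (f : ℕ → ℤ) :
    ∑ t ∈ T, f t = f 1 + ∑ a ∈ dvdAtoms T, f a + ∑ n ∈ dvdNonatoms T, f n := by
  have h1 : (1 : ℕ) ∉ dvdAtoms T := fun h => (mem_dvdAtoms.1 h).2.1 rfl
  have hsub : insert 1 (dvdAtoms T) ⊆ T :=
    Finset.insert_subset hT.one_mem (dvdAtoms_subset T)
  rw [← Finset.sum_sdiff hsub, Finset.sum_insert h1, dvdNonatoms]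
  ring

theorem card_eq_one_add_atoms_add_nonatoms {T : Finset ℕ} (hT : IsLcmClosed T) :
    T.card = 1 + (dvdAtoms T).card + (dvdNonatoms T).card := by
  have h := sum_eq_one_add_atoms_add_nonatoms hT (fun _ => 1)
  simp only [Finset.sum_const, nsmul_eq_mul, mul_one] at h
  exact_mod_cast h

theorem altLcm_eq_nonatoms {T : Finset ℕ} (hT : IsLcmClosed T) :
    altLcm T = 1 - ∑ a ∈ dvdAtoms T, (a : ℤ) + ∑ n ∈ dvdNonatoms T, crosscut T n * n := by
  rw [altLcm_eq_sum_crosscut hT, sum_eq_one_add_atoms_add_nonatoms hT, crosscut_one hT,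
    Finset.sum_congr rfl fun a ha => by rw [crosscut_of_mem_dvdAtoms hT ha, neg_one_mul],
    Finset.sum_neg_distrib]
  push_cast
  ring

theorem sum_crosscut_nonatoms {T : Finset ℕ} (hT : IsLcmClosed T) {t : ℕ} (ht : t ∈ T)
    (h1 : t ≠ 1) :
    ∑ n ∈ dvdNonatoms T with n ∣ t, crosscut T n = ({a ∈ dvdAtoms T | a ∣ t}.card : ℤ) - 1 := by
  have h := sum_crosscut_dvd hT ht
  rw [if_neg h1, Finset.sum_filter, sum_eq_one_add_atoms_add_nonatoms hT, if_pos (one_dvd t),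
    crosscut_one hT, ← Finset.sum_filter, ← Finset.sum_filter,
    Finset.sum_congr rfl fun a ha => crosscut_of_mem_dvdAtoms hT (Finset.mem_filter.1 ha).1,
    Finset.sum_const, nsmul_eq_mul] at h
  linarith

theorem lcm_mem_dvdNonatoms {T : Finset ℕ} (hT : IsLcmClosed T) {a b : ℕ} (ha : a ∈ dvdAtoms T)
    (hb : b ∈ dvdAtoms T) (hab : a ≠ b) : Nat.lcm a b ∈ dvdNonatoms T := by
  refine mem_dvdNonatoms.2 ⟨hT.lcm_mem _ (dvdAtoms_subset T ha) _ (dvdAtoms_subset T hb),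
    fun h => ?_, fun h => ?_⟩
  · exact (mem_dvdAtoms.1 ha).2.1 (Nat.dvd_one.1 (h ▸ Nat.dvd_lcm_left a b))
  · exact hab ((eq_of_dvd_of_mem_dvdAtoms ha h (Nat.dvd_lcm_left a b)).trans
      (eq_of_dvd_of_mem_dvdAtoms hb h (Nat.dvd_lcm_right a b)).symm)

/-- lcm(t, m) is again a nonatom, so maximality forces it to equal m. -/
theorem dvd_max_of_mem {T : Finset ℕ} (hT : IsLcmClosed T) {m : ℕ} (hm : m ∈ dvdNonatoms T)
    (hmax : ∀ n ∈ dvdNonatoms T, n ≤ m) {t : ℕ} (ht : t ∈ T) : t ∣ m := by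
  obtain ⟨hmT, hm1, hmA⟩ := mem_dvdNonatoms.1 hm
  have hl : Nat.lcm t m ∈ dvdNonatoms T := by
    refine mem_dvdNonatoms.2 ⟨hT.lcm_mem _ ht _ hmT, fun h => ?_, fun h => ?_⟩
    · exact hm1 (Nat.dvd_one.1 (h ▸ Nat.dvd_lcm_right t m))
    · rcases (mem_dvdAtoms.1 h).2.2 m hmT (Nat.dvd_lcm_right t m) with h' | h'
      · exact hm1 h'
      · exact hmA (h' ▸ h)
  have hpos : 0 < Nat.lcm t m := hT.pos _ (mem_dvdNonatoms.1 hl).1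
  have heq : Nat.lcm t m = m :=
    le_antisymm (hmax _ hl) (Nat.le_of_dvd hpos (Nat.dvd_lcm_right t m))
  exact heq ▸ Nat.dvd_lcm_left t m

theorem two_mul_atom_le {T : Finset ℕ} (hT : IsLcmClosed T) {a n : ℕ} (ha : a ∈ dvdAtoms T)
    (hn : n ∈ dvdNonatoms T) (h : a ∣ n) : 2 * a ≤ n := by
  obtain ⟨hnT, -, hnA⟩ := mem_dvdNonatoms.1 hn
  exact two_mul_le_of_dvd (hT.pos n hnT) h fun h' => hnA (h' ▸ ha)

/-- An atom is a proper divisor of any nonatom above it, so costs at most half of it. -/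
theorem two_mul_sum_atoms_le {T : Finset ℕ} (hT : IsLcmClosed T) {n : ℕ} {A : Finset ℕ}
    (hA : A ⊆ dvdAtoms T) (hn : n ∈ dvdNonatoms T) (h : ∀ a ∈ A, a ∣ n) :
    2 * ∑ a ∈ A, (a : ℤ) ≤ A.card * n := by
  rw [Finset.mul_sum, ← nsmul_eq_mul]
  exact Finset.sum_le_card_nsmul _ _ _ fun a ha => by
    exact_mod_cast two_mul_atom_le hT (hA ha) hn (h a ha)

theorem one_le_card_atoms_dvd {T : Finset ℕ} (hT : IsLcmClosed T) {n : ℕ}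
    (hn : n ∈ dvdNonatoms T) : 1 ≤ {a ∈ dvdAtoms T | a ∣ n}.card := by
  obtain ⟨a, ha, han⟩ := exists_dvdAtom_dvd hT (mem_dvdNonatoms.1 hn).1 (mem_dvdNonatoms.1 hn).2.1
  exact Finset.card_pos.2 ⟨a, Finset.mem_filter.2 ⟨ha, han⟩⟩

/-! ### Positivity with at least four atoms. -/

theorem altLcm_pos_of_nonatoms_singleton {T : Finset ℕ} (hT : IsLcmClosed T) {m : ℕ}
    (hN : dvdNonatoms T = {m}) (hk : 4 ≤ (dvdAtoms T).card) : 0 < altLcm T := by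
  have hm : m ∈ dvdNonatoms T := by simp [hN]
  obtain ⟨hmT, hm1, -⟩ := mem_dvdNonatoms.1 hm
  have htop : ∀ t ∈ T, t ∣ m := fun t ht => dvd_max_of_mem hT hm (by simp [hN]) ht
  have hw := sum_crosscut_nonatoms hT hmT hm1
  rw [Finset.filter_true_of_mem fun a ha => htop a (dvdAtoms_subset T ha), hN,
    Finset.filter_singleton, if_pos dvd_rfl, Finset.sum_singleton] at hw
  have hle := two_mul_sum_atoms_le hT subset_rfl hm fun a ha => htop a (dvdAtoms_subset T ha)
  have hmpos : (0 : ℤ) < m := by exact_mod_cast hT.pos m hmT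
  have hk' : (4 : ℤ) ≤ (dvdAtoms T).card := by exact_mod_cast hk
  rw [altLcm_eq_nonatoms hT, hN, Finset.sum_singleton, hw]
  nlinarith

/-- With u atoms below p and r others, the weights are u - 1 and r, so the sum is at least 1 + (u/2
- 1)p + (r/2)m. -/
theorem altLcm_pos_of_nonatoms_pair {T : Finset ℕ} (hT : IsLcmClosed T) {p m : ℕ} (hpm : p < m)
    (hN : dvdNonatoms T = {p, m}) (hk : 4 ≤ (dvdAtoms T).card) : 0 < altLcm T := by
  have hp : p ∈ dvdNonatoms T := by simp [hN]
  have hm : m ∈ dvdNonatoms T := by simp [hN]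
  obtain ⟨hpT, hp1, -⟩ := mem_dvdNonatoms.1 hp
  obtain ⟨hmT, hm1, -⟩ := mem_dvdNonatoms.1 hm
  have htop : ∀ t ∈ T, t ∣ m := fun t ht =>
    dvd_max_of_mem hT hm (by simp [hN, hpm.le]) ht
  have hppos := hT.pos p hpT
  have hmp : ¬ m ∣ p := fun h => absurd (Nat.le_of_dvd hppos h) (by omega)
  have hwp := sum_crosscut_nonatoms hT hpT hp1
  have hwm := sum_crosscut_nonatoms hT hmT hm1
  rw [Finset.sum_filter, hN, Finset.sum_pair hpm.ne, if_pos dvd_rfl, if_neg hmp] at hwp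
  rw [Finset.filter_true_of_mem fun a ha => htop a (dvdAtoms_subset T ha), Finset.sum_filter, hN,
    Finset.sum_pair hpm.ne, if_pos dvd_rfl, if_pos (htop p hpT)] at hwm
  have hu := one_le_card_atoms_dvd hT hp
  have hlep := two_mul_sum_atoms_le hT (Finset.filter_subset (· ∣ p) _) hp
    fun a ha => (Finset.mem_filter.1 ha).2
  have hlem := two_mul_sum_atoms_le hT (Finset.filter_subset (fun a => ¬ a ∣ p) _) hm
    fun a ha => htop a (dvdAtoms_subset T (Finset.mem_filter.1 ha).1)
  have hsum := Finset.sum_filter_add_sum_filter_not (dvdAtoms T) (· ∣ p) (fun a => (a : ℤ))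
  have hcard := Finset.card_filter_add_card_filter_not (s := dvdAtoms T) (· ∣ p)
  rw [altLcm_eq_nonatoms hT, hN, Finset.sum_pair hpm.ne]
  generalize crosscut T p = wp at *
  generalize crosscut T m = wm at *
  generalize ({a ∈ dvdAtoms T | a ∣ p}).card = u at *
  generalize ({a ∈ dvdAtoms T | ¬ a ∣ p}).card = r at *
  rw [← hcard] at hwm hk
  push_cast at hwm
  obtain rfl : wp = u - 1 := by linarith
  obtain rfl : wm = r := by linarith
  have hpm' : (p : ℤ) < m := by exact_mod_cast hpm
  have hp0 : (0 : ℤ) < p := by exact_mod_cast hppos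
  rcases Nat.lt_or_ge u 2 with h2 | h2
  · obtain rfl : u = 1 := by omega
    have : (3 : ℤ) ≤ r := by exact_mod_cast (by omega : 3 ≤ r)
    push_cast at *
    nlinarith
  · have : (2 : ℤ) ≤ u := by exact_mod_cast h2
    have : (0 : ℤ) ≤ r := by positivity
    nlinarith

/-- The lcm of two common atoms would be a nonatom dividing p, hence p itself by size, and it would
divide q. -/
theorem card_common_atoms_le_one {T : Finset ℕ} (hT : IsLcmClosed T) {p q m : ℕ} (hpq : p < q)
    (hqm : q < m) (hN : dvdNonatoms T = {p, q, m}) (hdvd : ¬ p ∣ q) :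
    {a ∈ dvdAtoms T | a ∣ p ∧ a ∣ q}.card ≤ 1 := by
  refine Finset.card_le_one.2 fun a ha b hb => ?_
  obtain ⟨ha, hap, haq⟩ := Finset.mem_filter.1 ha
  obtain ⟨hb, hbp, hbq⟩ := Finset.mem_filter.1 hb
  by_contra hab
  have hl := lcm_mem_dvdNonatoms hT ha hb hab
  have hlp := Nat.lcm_dvd hap hbp
  have hlq := Nat.lcm_dvd haq hbq
  have hp : p ∈ dvdNonatoms T := by simp [hN]
  have hle := Nat.le_of_dvd (hT.pos p (mem_dvdNonatoms.1 hp).1) hlp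
  rw [hN] at hl
  simp only [Finset.mem_insert, Finset.mem_singleton] at hl
  rcases hl with h | h | h
  · exact hdvd (h ▸ hlq)
  · omega
  · omega

theorem altLcm_pos_of_nonatoms_triple {T : Finset ℕ} (hT : IsLcmClosed T) {p q m : ℕ}
    (hpq : p < q) (hqm : q < m) (hN : dvdNonatoms T = {p, q, m})
    (hk : 4 ≤ (dvdAtoms T).card) : 0 < altLcm T := by
  have hp : p ∈ dvdNonatoms T := by simp [hN]
  have hq : q ∈ dvdNonatoms T := by simp [hN]
  have hm : m ∈ dvdNonatoms T := by simp [hN]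
  obtain ⟨hpT, hp1, -⟩ := mem_dvdNonatoms.1 hp
  obtain ⟨hqT, hq1, -⟩ := mem_dvdNonatoms.1 hq
  obtain ⟨hmT, hm1, -⟩ := mem_dvdNonatoms.1 hm
  have htop : ∀ t ∈ T, t ∣ m := fun t ht =>
    dvd_max_of_mem hT hm (by simp [hN, hqm.le, (hpq.trans hqm).le]) ht
  have hppos := hT.pos p hpT
  have hqpos := hT.pos q hqT
  have hmp : ¬ m ∣ p := fun h => absurd (Nat.le_of_dvd hppos h) (by omega)
  have hqp : ¬ q ∣ p := fun h => absurd (Nat.le_of_dvd hppos h) (by omega)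
  have hmq : ¬ m ∣ q := fun h => absurd (Nat.le_of_dvd hqpos h) (by omega)
  have hsum3 : ∀ f : ℕ → ℤ, ∑ n ∈ dvdNonatoms T, f n = f p + f q + f m := fun f => by
    rw [hN, Finset.sum_insert (by simp; omega), Finset.sum_pair hqm.ne, add_assoc]
  have hwp := sum_crosscut_nonatoms hT hpT hp1
  have hwq := sum_crosscut_nonatoms hT hqT hq1
  have hwm := sum_crosscut_nonatoms hT hmT hm1
  rw [Finset.sum_filter, hsum3, if_pos dvd_rfl, if_neg hqp, if_neg hmp] at hwp
  rw [Finset.sum_filter, hsum3, if_pos dvd_rfl, if_neg hmq] at hwq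
  rw [Finset.filter_true_of_mem fun a ha => htop a (dvdAtoms_subset T ha), Finset.sum_filter,
    hsum3, if_pos dvd_rfl, if_pos (htop p hpT), if_pos (htop q hqT)] at hwm
  have hu := one_le_card_atoms_dvd hT hp
  -- Each atom is charged to the first of p, q, m that it divides; the class sizes become u, v, r
  -- below.
  have hlep := two_mul_sum_atoms_le hT (Finset.filter_subset (· ∣ p) _) hp
    fun a ha => (Finset.mem_filter.1 ha).2
  have hleq := two_mul_sum_atoms_le hT (n := q)
    (A := {a ∈ {a ∈ dvdAtoms T | ¬ a ∣ p} | a ∣ q})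
    ((Finset.filter_subset _ _).trans (Finset.filter_subset _ _)) hq
    fun a ha => (Finset.mem_filter.1 ha).2
  have hlem := two_mul_sum_atoms_le hT (n := m)
    (A := {a ∈ {a ∈ dvdAtoms T | ¬ a ∣ p} | ¬ a ∣ q})
    ((Finset.filter_subset _ _).trans (Finset.filter_subset _ _)) hm
    fun a ha => htop a (dvdAtoms_subset T (Finset.mem_filter.1 (Finset.mem_filter.1 ha).1).1)
  have hsum := Finset.sum_filter_add_sum_filter_not (dvdAtoms T) (· ∣ p) (fun a => (a : ℤ))
  have hsum' := Finset.sum_filter_add_sum_filter_not {a ∈ dvdAtoms T | ¬ a ∣ p} (· ∣ q)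
    (fun a => (a : ℤ))
  have hcard := Finset.card_filter_add_card_filter_not (s := dvdAtoms T) (· ∣ p)
  have hcard' := Finset.card_filter_add_card_filter_not
    (s := {a ∈ dvdAtoms T | ¬ a ∣ p}) (· ∣ q)
  have hcardq : {a ∈ dvdAtoms T | a ∣ q}.card =
      {a ∈ dvdAtoms T | a ∣ p ∧ a ∣ q}.card +
        {a ∈ {a ∈ dvdAtoms T | ¬ a ∣ p} | a ∣ q}.card := by
    rw [← Finset.card_filter_add_card_filter_not (s := {a ∈ dvdAtoms T | a ∣ q}) (· ∣ p),
      Finset.filter_filter, Finset.filter_filter, Finset.filter_filter]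
    simp only [and_comm]
  have hcommon := card_common_atoms_le_one hT hpq hqm hN
  have hcommon' : p ∣ q → {a ∈ dvdAtoms T | a ∣ p ∧ a ∣ q}.card =
      {a ∈ dvdAtoms T | a ∣ p}.card := fun h => congrArg Finset.card <|
    Finset.filter_congr fun a _ => ⟨fun h' => h'.1, fun h' => ⟨h', h'.trans h⟩⟩
  have hq' := one_le_card_atoms_dvd hT hq
  rw [altLcm_eq_nonatoms hT, hsum3]
  generalize crosscut T p = wp at *
  generalize crosscut T q = wq at *
  generalize crosscut T m = wm at *
  generalize ({a ∈ dvdAtoms T | a ∣ p}).card = u at *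
  generalize ({a ∈ {a ∈ dvdAtoms T | ¬ a ∣ p} | a ∣ q}).card = v at *
  generalize ({a ∈ {a ∈ dvdAtoms T | ¬ a ∣ p} | ¬ a ∣ q}).card = r at *
  generalize ({a ∈ dvdAtoms T | a ∣ p ∧ a ∣ q}).card = e at *
  rw [← hcard, ← hcard'] at hwm hk
  rw [hcardq] at hwq hq'
  push_cast at hwm hwq
  have hpq' : (p : ℤ) < q := by exact_mod_cast hpq
  have hqm' : (q : ℤ) < m := by exact_mod_cast hqm
  have hp0 : (0 : ℤ) < p := by exact_mod_cast hppos
  obtain rfl : wp = u - 1 := by linarith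
  -- Both the comparable case and the case of a common atom reduce to these weights.
  have key : wq = v → wm = r → 0 < 1 - ∑ a ∈ dvdAtoms T, (a : ℤ) +
      ((u - 1) * p + wq * q + wm * m) := by
    rintro rfl rfl
    have hv0 : (0 : ℤ) ≤ v := by positivity
    have hr0 : (0 : ℤ) ≤ r := by positivity
    have h1 : (0 : ℤ) ≤ v * (q - p) := mul_nonneg hv0 (by linarith)
    have h2 : (0 : ℤ) ≤ r * (m - p) := mul_nonneg hr0 (by linarith)
    have h3 : (0 : ℤ) ≤ ((u : ℤ) + v + r - 2) * p :=
      mul_nonneg (by have : (4 : ℤ) ≤ u + (v + r) := by exact_mod_cast hk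
                     linarith) hp0.le
    nlinarith
  by_cases hd : p ∣ q
  · rw [if_pos hd, hcommon' hd] at hwq
    exact key (by linarith) (by linarith)
  · rw [if_neg hd] at hwq
    have he := hcommon hd
    interval_cases e
    -- No common atom: q loses one unit of weight and m gains one. As u, v ≥ 1, the sum is at least
    -- 1 - p/2 - q/2 + m.
    · obtain rfl : wq = v - 1 := by push_cast at hwq; linarith
      obtain rfl : wm = r + 1 := by linarith
      have hu' : (1 : ℤ) ≤ u := by exact_mod_cast hu
      have hv' : (1 : ℤ) ≤ v := by exact_mod_cast (by omega : 1 ≤ v)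
      have hr0 : (0 : ℤ) ≤ r := by positivity
      have h1 : (0 : ℤ) ≤ (u - 1) * p := mul_nonneg (by linarith) hp0.le
      have h2 : (0 : ℤ) ≤ (v - 1) * q := mul_nonneg (by linarith) (by linarith)
      have h3 : (0 : ℤ) ≤ r * m := mul_nonneg hr0 (by linarith)
      nlinarith
    · exact key (by push_cast at hwq; linarith) (by push_cast at hwq; linarith)

theorem altLcm_pos_of_four_le {T : Finset ℕ} (hT : IsLcmClosed T) (hcard : T.card ≤ 8)
    (hk : 4 ≤ (dvdAtoms T).card) : 0 < altLcm T := by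
  have hc := card_eq_one_add_atoms_add_nonatoms hT
  obtain ⟨a, ha, b, hb, hab⟩ := Finset.one_lt_card.1 (by omega : 1 < (dvdAtoms T).card)
  have hpos := Finset.card_pos.2 ⟨_, lcm_mem_dvdNonatoms hT ha hb hab⟩
  -- 1 and four atoms use five of the at most eight elements.
  obtain h | h | h : (dvdNonatoms T).card = 1 ∨ (dvdNonatoms T).card = 2 ∨
    (dvdNonatoms T).card = 3 := by omega
  · obtain ⟨m, hm⟩ := Finset.card_eq_one.1 h
    exact altLcm_pos_of_nonatoms_singleton hT hm hk
  · obtain ⟨p, m, hne, hN⟩ := Finset.card_eq_two.1 h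
    rcases lt_or_gt_of_ne hne with h | h
    · exact altLcm_pos_of_nonatoms_pair hT h hN hk
    · exact altLcm_pos_of_nonatoms_pair hT h (hN.trans (Finset.pair_comm _ _)) hk
  · obtain ⟨x, y, z, hxy, hxz, hyz, hN⟩ := Finset.card_eq_three.1 h
    have aux : ∀ p q m : ℕ, p < q → q < m → ({x, y, z} : Finset ℕ) = {p, q, m} →
        0 < altLcm T := fun p q m h1 h2 h3 =>
      altLcm_pos_of_nonatoms_triple hT h1 h2 (hN.trans h3) hk
    rcases lt_or_gt_of_ne hxy with h1 | h1 <;> rcases lt_or_gt_of_ne hxz with h2 | h2 <;>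
      rcases lt_or_gt_of_ne hyz with h3 | h3
    · exact aux x y z h1 h3 rfl
    · exact aux x z y h2 h3 (by grind)
    · omega
    · exact aux z x y h2 h1 (by grind)
    · exact aux y x z h1 h2 (by grind)
    · omega
    · exact aux y z x h3 h2 (by grind)
    · exact aux z y x h3 h1 (by grind)

/-! ### At most three atoms. -/

theorem sum_powerset_insert_neg_one_pow {s : Finset ℕ} {a : ℕ} (ha : a ∉ s)
    (f : Finset ℕ → ℤ) :
    ∑ I ∈ (insert a s).powerset, (-1) ^ I.card * f I =
      ∑ I ∈ s.powerset, (-1) ^ I.card * f I -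
        ∑ I ∈ s.powerset, (-1) ^ I.card * f (insert a I) := by
  rw [Finset.sum_powerset_insert ha, sub_eq_add_neg, ← Finset.sum_neg_distrib]
  congr 1
  refine Finset.sum_congr rfl fun I hI => ?_
  rw [Finset.card_insert_of_notMem fun h => ha (Finset.mem_powerset.1 hI h)]
  ring

/-- If the alternating sum vanishes and `T` is small, then three elements of `T` are independent
with respect to `lcm`. -/
theorem exists_independent_of_altLcm_eq_zero {T : Finset ℕ} (hT : IsLcmClosed T)
    (hcard : T.card ≤ 8) (h0 : altLcm T = 0) :
    ∃ a ∈ T, ∃ b ∈ T, ∃ c ∈ T,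
      ¬ a ∣ Nat.lcm b c ∧ ¬ b ∣ Nat.lcm a c ∧ ¬ c ∣ Nat.lcm a b := by
  have hanti : ∀ a ∈ dvdAtoms T, ∀ b ∈ dvdAtoms T, a ≠ b → (a : ℤ) + b < Nat.lcm a b :=
    fun a ha b hb hab => by
      exact_mod_cast add_lt_lcm (hT.pos a (dvdAtoms_subset T ha))
        (hT.pos b (dvdAtoms_subset T hb))
        (fun h => hab (eq_of_dvd_of_mem_dvdAtoms ha hb h))
        (fun h => hab (eq_of_dvd_of_mem_dvdAtoms hb ha h).symm)
  by_cases hk : 4 ≤ (dvdAtoms T).card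
  · exact absurd h0 (altLcm_pos_of_four_le hT hcard hk).ne'
  obtain h | h | h | h : (dvdAtoms T).card = 0 ∨ (dvdAtoms T).card = 1 ∨
    (dvdAtoms T).card = 2 ∨ (dvdAtoms T).card = 3 := by omega
  · rw [Finset.card_eq_zero] at h
    simp [altLcm, h] at h0
  · obtain ⟨a, ha⟩ := Finset.card_eq_one.1 h
    have hne : a ≠ 1 := (mem_dvdAtoms.1 (ha ▸ Finset.mem_singleton_self a : a ∈ dvdAtoms T)).2.1
    rw [altLcm, ha, ← insert_empty_eq, sum_powerset_insert_neg_one_pow (by simp)] at h0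
    simp only [Finset.powerset_empty, Finset.sum_singleton, Finset.card_empty, Finset.lcm_insert,
      Finset.lcm_empty, lcm_eq_nat_lcm, id, Nat.lcm_one_right] at h0
    omega
  · obtain ⟨a, b, hab, hA⟩ := Finset.card_eq_two.1 h
    have h1 := hanti a (by simp [hA]) b (by simp [hA]) hab
    rw [altLcm, hA, ← insert_empty_eq b, sum_powerset_insert_neg_one_pow (by simp [hab]),
      sum_powerset_insert_neg_one_pow (by simp), sum_powerset_insert_neg_one_pow (by simp)] at h0
    simp only [Finset.powerset_empty, Finset.sum_singleton, Finset.card_empty, Finset.lcm_insert,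
      Finset.lcm_empty, lcm_eq_nat_lcm, id, Nat.lcm_one_right] at h0
    push_cast at h0
    linarith
  · obtain ⟨a, b, c, hab, hac, hbc, hA⟩ := Finset.card_eq_three.1 h
    have ha : a ∈ dvdAtoms T := by simp [hA]
    have hb : b ∈ dvdAtoms T := by simp [hA]
    have hc : c ∈ dvdAtoms T := by simp [hA]
    refine ⟨a, dvdAtoms_subset T ha, b, dvdAtoms_subset T hb, c, dvdAtoms_subset T hc, ?_⟩
    have h1 := hanti a ha b hb hab
    have h2 := hanti a ha c hc hac
    have h3 := hanti b hb c hc hbc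
    rw [altLcm, hA, ← insert_empty_eq c,
      sum_powerset_insert_neg_one_pow (by simp [hab, hac]),
      sum_powerset_insert_neg_one_pow (by simp [hbc]),
      sum_powerset_insert_neg_one_pow (by simp), sum_powerset_insert_neg_one_pow (by simp),
      sum_powerset_insert_neg_one_pow (by simp [hbc]),
      sum_powerset_insert_neg_one_pow (by simp), sum_powerset_insert_neg_one_pow (by simp)] at h0
    simp only [Finset.powerset_empty, Finset.sum_singleton, Finset.card_empty, Finset.lcm_insert,
      Finset.lcm_empty, lcm_eq_nat_lcm, id, Nat.lcm_one_right] at h0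
    push_cast at h0
    -- If one atom divides the lcm of the other two, that lcm cancels the triple one; the two
    -- remaining pairwise lcms exceed the sum of the atoms.
    refine ⟨fun h => ?_, fun h => ?_, fun h => ?_⟩
    · rw [Nat.lcm_eq_right h] at h0
      linarith
    · have hl : Nat.lcm a (Nat.lcm b c) = Nat.lcm a c := by
        rw [← Nat.lcm_assoc, Nat.lcm_comm a b, Nat.lcm_assoc, Nat.lcm_eq_right h]
      rw [hl] at h0
      linarith
    · rw [← Nat.lcm_assoc, Nat.lcm_eq_left h] at h0
      linarith

/-! ### Factorization of the LCM matrix and passage to quotients. -/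

/-- The Möbius transform of `1 / x` over the divisors in `S`. -/
noncomputable def recipTransform (S : Finset ℕ) (x : ℕ) : ℝ :=
  (x : ℝ)⁻¹ - ∑ d ∈ (S.filter fun d => d ∣ x ∧ d < x).attach,
    have : d.1 < x := (Finset.mem_filter.1 d.2).2.2
    recipTransform S d.1
termination_by x

theorem sum_recipTransform {S : Finset ℕ} {x : ℕ} (hx : x ∈ S) (hpos : 0 < x) :
    ∑ d ∈ S with d ∣ x, recipTransform S d = (x : ℝ)⁻¹ := by
  have hset : {d ∈ S | d ∣ x} = insert x {d ∈ S | d ∣ x ∧ d < x} := by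
    ext d
    simp only [Finset.mem_filter, Finset.mem_insert]
    constructor
    · rintro ⟨hd, hdx⟩
      rcases (Nat.le_of_dvd hpos hdx).eq_or_lt with h | h
      · exact Or.inl h
      · exact Or.inr ⟨hd, hdx, h⟩
    · rintro (rfl | ⟨hd, hdx, -⟩)
      · exact ⟨hx, dvd_rfl⟩
      · exact ⟨hd, hdx⟩
  rw [hset, Finset.sum_insert (by simp), recipTransform,
    Finset.sum_attach _ (fun d => recipTransform S d)]
  ring

/-- The quotients of `x` by its divisors in `S`. -/
def codivisors (S : Finset ℕ) (x : ℕ) : Finset ℕ :=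
  (S.filter (· ∣ x)).image (x / ·)

theorem mem_codivisors {S : Finset ℕ} {x t : ℕ} (hx : 0 < x) :
    t ∈ codivisors S x ↔ t ∣ x ∧ x / t ∈ S := by
  simp only [codivisors, Finset.mem_image, Finset.mem_filter]
  constructor
  · rintro ⟨s, ⟨hs, hsx⟩, rfl⟩
    exact ⟨Nat.div_dvd_of_dvd hsx, by rwa [Nat.div_div_self hsx hx.ne']⟩
  · rintro ⟨ht, hs⟩
    exact ⟨x / t, ⟨hs, Nat.div_dvd_of_dvd ht⟩, Nat.div_div_self ht hx.ne'⟩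

theorem div_dvd_div_iff_dvd {x a b : ℕ} (hx : 0 < x) (ha : a ∣ x) (hb : b ∣ x) :
    x / a ∣ x / b ↔ b ∣ a := by
  obtain ⟨u, rfl⟩ := ha
  obtain ⟨v, hv⟩ := hb
  have ha0 : 0 < a := Nat.pos_of_mul_pos_right hx
  have hb0 : 0 < b := by
    rw [hv] at hx
    exact Nat.pos_of_mul_pos_right hx
  have hu0 : 0 < u := Nat.pos_of_mul_pos_left hx
  rw [Nat.mul_div_cancel_left _ ha0, hv, Nat.mul_div_cancel_left _ hb0]
  have hv0 : 0 < v := by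
    rw [hv] at hx
    exact Nat.pos_of_mul_pos_left hx
  constructor
  · rintro ⟨w, rfl⟩
    exact ⟨w, Nat.eq_of_mul_eq_mul_right hu0 (by rw [hv]; ring)⟩
  · rintro ⟨w, rfl⟩
    exact ⟨w, Nat.eq_of_mul_eq_mul_left hb0 (by rw [← hv]; ring)⟩

/-- t ↦ x / t reverses divisibility among the divisors of x, so it turns lcm into gcd. -/
theorem isLcmClosed_codivisors {S : Finset ℕ} (hpos : ∀ x ∈ S, 0 < x) (hS : GCDClosed S) {x : ℕ}
    (hx : x ∈ S) : IsLcmClosed (codivisors S x) := by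
  have hx0 := hpos x hx
  refine ⟨fun t ht => Nat.pos_of_dvd_of_pos ((mem_codivisors hx0).1 ht).1 hx0,
    (mem_codivisors hx0).2 ⟨one_dvd x, by simpa⟩, fun a ha b hb => ?_⟩
  obtain ⟨hax, ha⟩ := (mem_codivisors hx0).1 ha
  obtain ⟨hbx, hb⟩ := (mem_codivisors hx0).1 hb
  have hl := Nat.lcm_dvd hax hbx
  refine (mem_codivisors hx0).2 ⟨hl, ?_⟩
  have hg : x / Nat.lcm a b = Nat.gcd (x / a) (x / b) := by
    apply Nat.dvd_antisymm
    · exact Nat.dvd_gcd ((div_dvd_div_iff_dvd hx0 hl hax).2 (Nat.dvd_lcm_left a b))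
        ((div_dvd_div_iff_dvd hx0 hl hbx).2 (Nat.dvd_lcm_right a b))
    · have hgx : Nat.gcd (x / a) (x / b) ∣ x :=
        (Nat.gcd_dvd_left _ _).trans (Nat.div_dvd_of_dvd hax)
      rw [← Nat.div_div_self hgx hx0.ne']
      refine (div_dvd_div_iff_dvd hx0 (Nat.div_dvd_of_dvd hgx) hl).2 (Nat.lcm_dvd ?_ ?_)
      · rw [← div_dvd_div_iff_dvd hx0 (Nat.div_dvd_of_dvd hgx) hax, Nat.div_div_self hgx hx0.ne']
        exact Nat.gcd_dvd_left _ _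
      · rw [← div_dvd_div_iff_dvd hx0 (Nat.div_dvd_of_dvd hgx) hbx, Nat.div_div_self hgx hx0.ne']
        exact Nat.gcd_dvd_right _ _
  rw [hg]
  exact hS _ ha _ hb

theorem card_codivisors_le (S : Finset ℕ) (x : ℕ) : (codivisors S x).card ≤ S.card :=
  Finset.card_image_le.trans (Finset.card_filter_le _ _)

/-- Möbius inversion: write t = x · 1/(x/t) as x times the sum of g(d) over d ∣ x/t, equivalently t
∣ x/d. After exchanging sums, `sum_crosscut_dvd` kills every d except d = x. -/
theorem altLcm_codivisors {S : Finset ℕ} (hpos : ∀ x ∈ S, 0 < x) (hS : GCDClosed S) {x : ℕ}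
    (hx : x ∈ S) : (altLcm (codivisors S x) : ℝ) = x * recipTransform S x := by
  have hx0 := hpos x hx
  have hT := isLcmClosed_codivisors hpos hS hx
  have hterm : ∀ t ∈ codivisors S x, (t : ℝ) =
      x * ∑ d ∈ {d ∈ S | d ∣ x}, if t ∣ x / d then recipTransform S d else 0 := by
    intro t ht
    obtain ⟨htx, htS⟩ := (mem_codivisors hx0).1 ht
    have ht0 := hT.pos t ht
    have hs := sum_recipTransform htS (hpos _ htS)
    have hset : {d ∈ S | d ∣ x / t} = {d ∈ {d ∈ S | d ∣ x} | t ∣ x / d} := by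
      ext d
      simp only [Finset.mem_filter, and_assoc]
      refine and_congr_right fun hd => ⟨fun h => ?_, fun h => ?_⟩
      · have hdx := h.trans (Nat.div_dvd_of_dvd htx)
        exact ⟨hdx, by rwa [← div_dvd_div_iff_dvd hx0 (Nat.div_dvd_of_dvd hdx) htx,
          Nat.div_div_self hdx hx0.ne']⟩
      · have h' := (div_dvd_div_iff_dvd hx0 (Nat.div_dvd_of_dvd h.1) htx).2 h.2
        rwa [Nat.div_div_self h.1 hx0.ne'] at h'
    rw [← Finset.sum_filter, ← hset, hs, Nat.cast_div htx (by positivity)]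
    field_simp
  rw [altLcm_eq_sum_crosscut hT]
  push_cast
  have h1 : ∑ t ∈ codivisors S x, (crosscut (codivisors S x) t : ℝ) * t =
      x * ∑ d ∈ {d ∈ S | d ∣ x}, recipTransform S d *
        ∑ t ∈ codivisors S x with t ∣ x / d, (crosscut (codivisors S x) t : ℝ) := by
    rw [Finset.sum_congr rfl fun t ht => by rw [hterm t ht]]
    generalize {d ∈ S | d ∣ x} = D
    simp only [Finset.mul_sum, Finset.sum_filter (fun t => t ∣ _)]
    rw [Finset.sum_comm]
    refine Finset.sum_congr rfl fun d _ => Finset.sum_congr rfl fun t _ => ?_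
    split_ifs <;> ring
  have h2 : ∀ d ∈ {d ∈ S | d ∣ x}, recipTransform S d *
      ∑ t ∈ codivisors S x with t ∣ x / d, (crosscut (codivisors S x) t : ℝ) =
      if d = x then recipTransform S d else 0 := by
    intro d hd
    obtain ⟨hdS, hdx⟩ := Finset.mem_filter.1 hd
    have hdT : x / d ∈ codivisors S x :=
      (mem_codivisors hx0).2 ⟨Nat.div_dvd_of_dvd hdx, by rwa [Nat.div_div_self hdx hx0.ne']⟩
    have hiff : x / d = 1 ↔ d = x := by
      constructor
      · intro h
        rw [← Nat.div_mul_cancel hdx, h, one_mul]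
      · rintro rfl
        exact Nat.div_self hx0
    have h := sum_crosscut_dvd hT hdT
    rw [← Int.cast_sum, h]
    simp only [hiff]
    split_ifs <;> simp
  rw [h1, Finset.sum_congr rfl h2, Finset.sum_ite_eq', if_pos (by simp [hx])]

theorem lcmMatrix_eq_mul {S : Finset ℕ} (hpos : ∀ x ∈ S, 0 < x) (hS : GCDClosed S) :
    let B : Matrix S S ℝ := Matrix.of fun a d => if (d : ℕ) ∣ a then (a : ℝ) else 0
    lcmMatrix S = B * Matrix.diagonal (fun d : S => recipTransform S d) * B.transpose := by
  intro B
  ext a b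
  have hg := hS a a.2 b b.2
  have hs := sum_recipTransform hg (hpos _ hg)
  have hterm : ∀ d : S, (B * Matrix.diagonal (fun d : S => recipTransform S d)) a d *
      B.transpose d b = a * b * if (d : ℕ) ∣ Nat.gcd a b then recipTransform S d else 0 := by
    intro d
    simp only [B, Matrix.mul_diagonal, Matrix.transpose_apply, Matrix.of_apply, Nat.dvd_gcd_iff]
    by_cases ha : (d : ℕ) ∣ a <;> by_cases hb : (d : ℕ) ∣ b <;> simp [ha, hb]
    ring
  rw [Matrix.mul_apply, Finset.sum_congr rfl fun d _ => hterm d, ← Finset.mul_sum,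
    Finset.sum_coe_sort S (fun d => if d ∣ Nat.gcd a b then recipTransform S d else 0),
    ← Finset.sum_filter, hs, lcmMatrix, Matrix.of_apply]
  have hg0 : (Nat.gcd a b : ℝ) ≠ 0 := by exact_mod_cast (hpos _ hg).ne'
  rw [eq_mul_inv_iff_mul_eq₀ hg0]
  exact_mod_cast (mul_comm _ _).trans (Nat.gcd_mul_lcm a b)

theorem exists_altLcm_eq_zero_of_not_isUnit {S : Finset ℕ} (hpos : ∀ x ∈ S, 0 < x)
    (hS : GCDClosed S) (hu : ¬ IsUnit (lcmMatrix S)) :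
    ∃ x ∈ S, altLcm (codivisors S x) = 0 := by
  by_contra! h
  refine hu ((Matrix.isUnit_iff_isUnit_det _).2 (isUnit_iff_ne_zero.2 ?_))
  rw [lcmMatrix_eq_mul hpos hS, Matrix.det_mul, Matrix.det_mul, Matrix.det_transpose,
    Matrix.det_diagonal]
  -- B is triangular for the usual order, as divisors are no larger, with diagonal entries a.
  have hB : (Matrix.of fun a d : S => if (d : ℕ) ∣ a then ((a : ℕ) : ℝ) else 0).det ≠ 0 := by
    rw [Matrix.det_of_isLowerTriangular]
    · refine Finset.prod_ne_zero_iff.2 fun a _ => ?_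
      simpa using (hpos a a.2).ne'
    · intro a d had
      have had' : (a : ℕ) < d := had
      simp only [Matrix.of_apply]
      exact if_neg fun hd => absurd (Nat.le_of_dvd (hpos a a.2) hd) (by omega)
  refine mul_ne_zero (mul_ne_zero hB (Finset.prod_ne_zero_iff.2 fun d _ h0 => ?_)) hB
  have := altLcm_codivisors hpos hS d.2
  rw [h0, mul_zero] at this
  exact h d d.2 (by exact_mod_cast this)

/-! ### The cube inside S. -/

/-- Three elements that are independent with respect to `lcm` generate a cube, which embeds in
`(S, ∣)` by taking quotients. -/
theorem exists_cube_embedding {S : Finset ℕ} (hpos : ∀ x ∈ S, 0 < x) (hS : GCDClosed S)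
    (hcard : S.card ≤ 8) (hu : ¬ IsUnit (lcmMatrix S)) :
    Nonempty (cubeRel ↪r dvdRel S) := by
  obtain ⟨x, hx, h0⟩ := exists_altLcm_eq_zero_of_not_isUnit hpos hS hu
  have hx0 := hpos x hx
  have hT := isLcmClosed_codivisors hpos hS hx
  obtain ⟨a, ha, b, hb, c, hc, hna, hnb, hnc⟩ :=
    exists_independent_of_altLcm_eq_zero hT ((card_codivisors_le S x).trans hcard) h0
  let α : Fin 3 → ℕ := ![a, b, c]
  have hα : ∀ i, α i ∈ codivisors S x := by
    intro i
    fin_cases i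
    exacts [ha, hb, hc]
  have hind : ∀ i, ¬ α i ∣ (Finset.univ.erase i).lcm α := by
    have h0 : (Finset.univ.erase (0 : Fin 3)) = {1, 2} := by decide
    have h1 : (Finset.univ.erase (1 : Fin 3)) = {0, 2} := by decide
    have h2 : (Finset.univ.erase (2 : Fin 3)) = {0, 1} := by decide
    intro i
    fin_cases i
    · simpa [h0, α, lcm_eq_nat_lcm] using hna
    · simpa [h1, α, lcm_eq_nat_lcm] using hnb
    · simpa [h2, α, lcm_eq_nat_lcm] using hnc
  have hg : ∀ I : Finset (Fin 3), I.lcm α ∈ codivisors S x := fun I => by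
    have := hT.finset_lcm_mem (I := I.image α) (Finset.image_subset_iff.2 fun i _ => hα i)
    rwa [Finset.lcm_image, Function.id_comp] at this
  -- An i in I outside J would make α i divide the lcm of the other two.
  have hgdvd : ∀ I J : Finset (Fin 3), I.lcm α ∣ J.lcm α ↔ I ⊆ J := by
    refine fun I J => ⟨fun h i hi => ?_, fun h => Finset.lcm_mono h⟩
    by_contra hJ
    exact hind i ((Finset.dvd_lcm hi).trans (h.trans (Finset.lcm_mono fun j hj =>
      Finset.mem_erase.2 ⟨fun hij => hJ (hij ▸ hj), Finset.mem_univ j⟩)))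
  have hmem := fun I => (mem_codivisors hx0).1 (hg I)
  -- The complement undoes the order reversal of t ↦ x / t.
  let f : Finset (Fin 3) → S := fun I => ⟨x / Iᶜ.lcm α, (hmem Iᶜ).2⟩
  have hf : ∀ I J, dvdRel S (f I) (f J) ↔ cubeRel I J := fun I J => by
    refine (div_dvd_div_iff_dvd hx0 (hmem _).1 (hmem _).1).trans ((hgdvd _ _).trans ?_)
    exact compl_le_compl_iff_le
  refine ⟨⟨⟨f, fun I J h => ?_⟩, fun {I J} => hf I J⟩⟩
  exact Finset.Subset.antisymm ((hf I J).1 (h ▸ dvd_rfl)) ((hf J I).1 (h ▸ dvd_rfl))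

theorem mainTheorem4 :
    (∀ S : Finset ℕ, (∀ x ∈ S, 0 < x) → GCDClosed S → S.card ≤ 7 → IsUnit (lcmMatrix S)) ∧
    (∀ S : Finset ℕ, (∀ x ∈ S, 0 < x) → GCDClosed S → S.card = 8 → ¬ IsUnit (lcmMatrix S) →
      Nonempty (dvdRel S ≃r cubeRel)) := by
  refine ⟨fun S hpos hS hcard => ?_, fun S hpos hS hcard hu => ?_⟩
  · by_contra hu
    obtain ⟨f⟩ := exists_cube_embedding hpos hS (by omega) hu
    have h := Fintype.card_le_of_injective f f.injective
    simp at h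
    omega
  · obtain ⟨f⟩ := exists_cube_embedding hpos hS hcard.le hu
    have hbij : Function.Bijective f :=
      (Fintype.bijective_iff_injective_and_card f).2 ⟨f.injective, by simp [hcard]⟩
    exact ⟨(RelIso.ofSurjective f hbij.2).symm⟩
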